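/- Let $\lambda$ be the usual product measure on the Cantor set $2^\omega$, let $\mathcal E$ be the ideal of all $A\subseteq 2^\omega$ with $\lambda(\overline A)=0$, and let $\kappa_0=\mathrm{cov}(\mathcal E)$ be the least cardinality of a covering of $2^\omega$ by sets from $\mathcal E$. Let $\mathrm{cof}[\kappa_0]^{\le\omega}$ be the least size of a family $\mathcal J$ of countable subsets of $\kappa_0$ such that every countable subset of $\kappa_0$ is contained in some $J\in\mathcal J$, and let $\mathfrak b$ be the bounding number, that is, the least cardinality of a family in $\omega^\omega$ that is unbounded with respect to eventual domination. Consider the assumption $$(*)\qquad \mathrm{cof}[\kappa_0]^{\le\omega}\le\mathfrak b .$$ Assume $(*)$. Then there is a compactification $\gamma\omega$ of the discrete space $\omega$ (a compact Hausdorff space containing $\omega$ as a dense discrete subspace) whose remainder $\gamma\omega\setminus\omega$ is not separable but carries a strictly positive regular Borel probability measure, i.e. one that is positive on every nonempty open subset of the remainder. Moreover, $(*)$ holds whenever $\mathfrak b=\mathfrak c$, where $\mathfrak c$ is the cardinality of the continuum. -/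

import Mathlib

open Set Filter Topology MeasureTheory
open scoped Cardinal

noncomputable section

/-- The fair coin measure on `{0, 1}`. -/
def coinMeasure : Measure Bool := (PMF.uniformOfFintype Bool).toMeasure

instance : IsProbabilityMeasure coinMeasure :=
  PMF.toMeasure.isProbabilityMeasure _

/-- The usual product measure `λ` on the Cantor set `2^ω`. -/
def cantorMeasure : Measure (ℕ → Bool) := Measure.infinitePi fun _ : ℕ => coinMeasure

/-- The family `𝓔` of all subsets of `2^ω` whose closure has `λ`-measure zero. -/
def idealE : Set (Set (ℕ → Bool)) := {A | cantorMeasure (closure A) = 0}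

/-- `cov(𝓔)`: the least cardinality of a covering of `2^ω` by sets from `𝓔`. -/
def covE : Cardinal.{0} :=
  sInf {c | ∃ F : Set (Set (ℕ → Bool)), F ⊆ idealE ∧ ⋃₀ F = univ ∧ #F = c}

/-- `[κ]^{≤ω}`: the countable subsets of (a set of cardinality) `κ`, ordered by inclusion. -/
abbrev CountableSubsets (κ : Cardinal.{0}) : Type := {A : Set κ.out // A.Countable}

/-- The bounding number `𝔟`: the least cardinality of a family of functions `ω → ω` that has no
upper bound for eventual domination. -/
def boundingNumber : Cardinal.{0} :=
  sInf {c | ∃ F : Set (ℕ → ℕ), (¬ ∃ g : ℕ → ℕ, ∀ f ∈ F, ∀ᶠ n in atTop, f n ≤ g n) ∧ #F = c}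

/-- The assumption `(*)`: `cof [κ₀]^{≤ω} ≤ 𝔟`, where `κ₀ = cov(𝓔)`. -/
def CofinalityAssumption : Prop := Order.cof (CountableSubsets covE) ≤ boundingNumber

/-- `γ : ω → X` is a compactification of the discrete space `ω`: `X` is a compact Hausdorff space
and `γ` is a homeomorphic embedding onto a dense subspace of `X`. -/
structure IsCompactification {X : Type} [TopologicalSpace X] (γ : ℕ → X) : Prop where
  compact : CompactSpace X
  hausdorff : T2Space X
  embedding : IsEmbedding γ
  dense : DenseRange γ

/-- The remainder `γω ∖ ω` of a compactification, a subspace of `X`. -/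
abbrev Remainder {X : Type} (γ : ℕ → X) : Type := ↥((range γ)ᶜ)

end

/-!
The remainder is a compact space `K` obtained from closed sets `F t ⊆ 2^ω`, `t ∈ T`: `K = {(z, y)
∈ 2^ω × 2^T | ∀ t, y t = 1 → z ∈ F t}`. Here `T` indexes a cofinal family of countable subsets of
`cov(𝓔)`; under `(*)` it can be taken of size at most `𝔟` and well-ordered with all proper initial
segments of size less than `𝔟`. Fix a covering of `2^ω` by `cov(𝓔)` closed null sets. Three facts
about `K` give the theorem.

*Not separable.* `F t` is nonempty and disjoint from the covering null sets indexed by the `t`-th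
countable set. The first coordinates of the points of a countable set lie in countably many null
sets of the covering, hence in those indexed by the `t`-th set for some `t`, and then the set
misses the nonempty open set `{y t = 1}`.

*Strictly positive measure.* All finite intersections of the sets `F t` are self-supporting: every
nonempty relatively open part has positive measure. So `K` supports the distribution of a random
point `(z, y)` in which `z` has distribution `λ` and, given `z`, independent coin flips decide `y
t` for those `t` with `z ∈ F t`. This distribution lives on the Baire sets only; the
Riesz–Markov–Kakutani theorem turns it into a regular Borel measure
(`exists_regular_strictlyPositive`). The sets `F t` are chosen by transfinite recursion
(`exists_selfSupporting_family`), and the inductive step `exists_closed_avoiding` is a domination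
argument with fewer than `𝔟` requirements.

*A remainder of `ω`.* `K` is the set of cluster points of a sequence `k ↦ (x k, (1_{C t}(k))_t)`,
and the set of cluster points of any sequence in a compact Hausdorff space is the remainder of a
compactification (`exists_compactification`). The sets `C t ⊆ ω` are again chosen by transfinite
recursion (`exists_independent_sets`): `x` has to converge to `F t` along `C t`, and `C t` has to
split the fewer than `𝔟` sets that the earlier choices and basic open sets of `2^ω` define, as far
as these accumulate at `F t`. This is possible by `exists_splitting_pseudoIntersection`.

The implication `𝔟 = 𝔠 → (*)` is the computation `#[cov(𝓔)]^{≤ω} ≤ 𝔠^ℵ₀ = 𝔠`.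
-/

/-! ### The bounding number -/

theorem not_bounded_univ :
    ¬ ∃ g : ℕ → ℕ, ∀ f ∈ (univ : Set (ℕ → ℕ)), ∀ᶠ n in atTop, f n ≤ g n := by
  rintro ⟨g, hg⟩
  obtain ⟨n, hn⟩ := (hg (fun n => g n + 1) (mem_univ _)).exists
  omega

theorem exists_eventually_le_of_lt_boundingNumber {ι : Type} (h : #ι < boundingNumber)
    (f : ι → ℕ → ℕ) : ∃ g : ℕ → ℕ, ∀ i, ∀ᶠ n in atTop, f i n ≤ g n := by
  by_contra hf
  refine (Cardinal.mk_range_le (f := f)).trans_lt h |>.not_ge (csInf_le' ⟨range f, ?_, rfl⟩)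
  simpa using hf

theorem aleph0_lt_boundingNumber : ℵ₀ < boundingNumber := by
  obtain ⟨F, hF, hc⟩ : boundingNumber ∈ _ := csInf_mem ⟨_, univ, not_bounded_univ, rfl⟩
  rw [← hc, ← not_le, Cardinal.le_aleph0_iff_set_countable]
  intro hcount
  apply hF
  obtain rfl | hne := F.eq_empty_or_nonempty
  · simp
  obtain ⟨f, rfl⟩ := hcount.exists_eq_range hne
  refine ⟨fun n => (Finset.range (n + 1)).sup fun i => f i n, ?_⟩
  rintro _ ⟨i, rfl⟩
  filter_upwards [eventually_ge_atTop i] with n hn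
  exact Finset.le_sup (f := fun i => f i n) (Finset.mem_range.2 (by omega))

/-- Fewer than `𝔟` functions on a countably infinite set are dominated by one function, up to
finitely many arguments. -/
theorem exists_cofinite_le_of_lt_boundingNumber {ι D : Type} [Denumerable D]
    (h : #ι < boundingNumber) (f : ι → D → ℕ) :
    ∃ g : D → ℕ, ∀ i, ∀ᶠ d in cofinite, f i d ≤ g d := by
  obtain ⟨g, hg⟩ := exists_eventually_le_of_lt_boundingNumber h
    fun i n => f i ((Denumerable.eqv D).symm n)
  refine ⟨fun d => g (Denumerable.eqv D d), fun i => ?_⟩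
  have := (Nat.cofinite_eq_atTop ▸ (Denumerable.eqv D).injective.tendsto_cofinite).eventually (hg i)
  simpa using this

theorem mk_finset_lt_boundingNumber {ι : Type} (h : #ι < boundingNumber) :
    #(Finset ι) < boundingNumber := by
  classical
  calc #(Finset ι) ≤ #(List ι) := Cardinal.mk_le_of_surjective (f := List.toFinset) fun s => by
        exact ⟨s.toList, by simp⟩
    _ ≤ max ℵ₀ #ι := Cardinal.mk_list_le_max ι
    _ < boundingNumber := max_lt aleph0_lt_boundingNumber h

theorem mk_prod_lt_boundingNumber {ι κ : Type} (h : #ι < boundingNumber)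
    (h' : #κ < boundingNumber) : #(ι × κ) < boundingNumber := by
  rw [Cardinal.mk_prod, Cardinal.lift_id, Cardinal.lift_id]
  exact Cardinal.mul_lt_of_lt aleph0_lt_boundingNumber.le h h'

/-- Fewer than `𝔟` infinite sets of integers can be split by one set (`𝔟 ≤ 𝔯`): a function
dominating their enumerations gives an interval partition almost all of whose blocks meet each of
the sets, and the union of every other block splits them. -/
theorem exists_split {ι : Type} (h : #ι < boundingNumber) (B : ι → Set ℕ)
    (hB : ∀ i, (B i).Infinite) : ∃ S : Set ℕ, ∀ i, (B i ∩ S).Infinite ∧ (B i \ S).Infinite := by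
  choose f hfB hf using fun i n => (hB i).exists_gt n
  obtain ⟨g, hg⟩ := exists_eventually_le_of_lt_boundingNumber h f
  -- The ends `a k` of the blocks. For almost all `k`, a member of `B i` above `a k` is found below
  -- `a (k + 1)`.
  let a : ℕ → ℕ := fun k => Nat.rec 0 (fun _ m => max (g m) m + 1) k
  have ha : ∀ k, a (k + 1) = max (g (a k)) (a k) + 1 := fun k => rfl
  have hmono : StrictMono a := strictMono_nat_of_lt_succ fun k => by rw [ha]; omega
  have hblock : ∀ i, ∀ᶠ k in atTop, ∃ b ∈ B i, a k < b ∧ b < a (k + 1) := fun i => by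
    filter_upwards [hmono.tendsto_atTop.eventually (hg i)] with k hk
    exact ⟨f i (a k), hfB _ _, hf _ _, by rw [ha]; omega⟩
  refine ⟨{n | ∃ k, a (2 * k) < n ∧ n < a (2 * k + 1)}, fun i => ⟨?_, ?_⟩⟩
  · refine infinite_of_forall_exists_gt fun n => ?_
    obtain ⟨m, hm⟩ := eventually_atTop.1 (hblock i)
    obtain ⟨b, hb, h1, h2⟩ := hm (2 * (m + n)) (by omega)
    have := hmono.le_apply (x := 2 * (m + n))
    exact ⟨b, ⟨hb, _, h1, h2⟩, by omega⟩
  · refine infinite_of_forall_exists_gt fun n => ?_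
    obtain ⟨m, hm⟩ := eventually_atTop.1 (hblock i)
    obtain ⟨b, hb, h1, h2⟩ := hm (2 * (m + n) + 1) (by omega)
    have := hmono.le_apply (x := 2 * (m + n) + 1)
    refine ⟨b, ⟨hb, ?_⟩, by omega⟩
    rintro ⟨k, h3, h4⟩
    have h5 : 2 * (m + n) + 1 < 2 * k + 1 := hmono.lt_iff_lt.1 (h1.trans h4)
    have h6 : 2 * k < 2 * (m + n) + 1 + 1 := hmono.lt_iff_lt.1 (h3.trans h2)
    omega

/-- The set `C` is almost contained in every `D n` and splits each of the given sets that has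
infinite intersection with every `D n`. -/
theorem exists_splitting_pseudoIntersection {ι : Type} (h : #ι < boundingNumber) (B : ι → Set ℕ)
    (hB : ∀ i, (B i).Infinite) (D : ℕ → Set ℕ) (hD : Antitone D) :
    ∃ C : Set ℕ, (∀ n, (C \ D n).Finite) ∧ ∀ i,
      ((∀ n, (B i ∩ D n).Infinite) → (B i ∩ C).Infinite) ∧ (B i \ C).Infinite := by
  let ι' := {i : ι // ∀ n, (B i ∩ D n).Infinite}
  have hι' : #ι' < boundingNumber := (Cardinal.mk_subtype_le _).trans_lt h
  choose f hfB hf using fun (i : ι') n => (i.2 n).exists_gt n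
  obtain ⟨g, hg⟩ := exists_eventually_le_of_lt_boundingNumber hι' f
  let C : Set ℕ := {k | ∃ n, k ∈ D n ∧ n ≤ k ∧ k ≤ g n}
  have hC : ∀ n, (C \ D n).Finite := fun n => by
    refine ((Finset.range n).finite_toSet.biUnion fun m _ => finite_Iic (g m)).subset ?_
    rintro k ⟨⟨m, hm, -, hkg⟩, hk⟩
    refine mem_biUnion (x := m) ?_ hkg
    by_contra hmn
    exact hk (hD (by simpa using hmn) hm)
  have hCB : ∀ i : ι', (B i ∩ C).Infinite := fun i => by
    refine infinite_of_forall_exists_gt fun n => ?_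
    obtain ⟨m, hm, hnm⟩ := ((hg i).and (eventually_ge_atTop n)).exists
    exact ⟨f i m, ⟨(hfB i m).1, m, (hfB i m).2, (hf i m).le, hm⟩, hnm.trans_lt (hf i m)⟩
  obtain ⟨S, hS⟩ := exists_split hι' _ hCB
  refine ⟨C ∩ S, fun n => (hC n).subset (sdiff_subset_sdiff_left inter_subset_left), fun i => ⟨
    fun hi => by simpa only [inter_assoc] using (hS ⟨i, hi⟩).1, ?_⟩⟩
  by_cases hi : ∀ n, (B i ∩ D n).Infinite
  · refine (hS ⟨i, hi⟩).2.mono ?_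
    rintro k ⟨⟨hk, -⟩, hkS⟩
    exact ⟨hk, fun hk' => hkS hk'.2⟩
  · push Not at hi
    obtain ⟨n, hn⟩ := hi
    refine ((hB i).sdiff (hn.union (hC n))).mono ?_
    rintro k ⟨hk, hk'⟩
    refine ⟨hk, fun hkC => hk' ?_⟩
    by_cases hkD : k ∈ D n
    · exact Or.inl ⟨hk, hkD⟩
    · exact Or.inr ⟨hkC.1, hkD⟩

/-- Transfinite recursion: if at every stage `t` a choice satisfying `P t` exists whenever the
earlier choices were good, then all the choices can be made. -/
theorem exists_forall_of_step {T α : Type} [Nonempty α] [LinearOrder T] [WellFoundedLT T]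
    (P : ∀ t : T, (Iio t → α) → α → Prop)
    (h : ∀ t (f : T → α), (∀ s < t, P s (fun u => f u) (f s)) → ∃ a, P t (fun u => f u) a) :
    ∃ f : T → α, ∀ t, P t (fun u => f u) (f t) := by
  classical
  let f : T → α := wellFounded_lt.fix (C := fun _ => α) fun t g =>
    if h : ∃ a, P t (fun u => g u u.2) a then h.choose else Classical.arbitrary α
  have hf : ∀ t, f t = if h : ∃ a, P t (fun u => f u) a then h.choose else
      Classical.arbitrary α := fun t => WellFounded.fix_eq _ _ t
  refine ⟨f, fun t => ?_⟩
  induction t using WellFoundedLT.induction with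
  | ind t ih =>
    have ht := h t f ih
    rw [hf t, dif_pos ht]
    exact ht.choose_spec

/-! ### Self-supporting closed sets avoiding null sets -/

instance : IsProbabilityMeasure cantorMeasure := by
  unfold cantorMeasure; infer_instance

/-- A set `H ⊆ 2^ω` is self-supporting if every nonempty relatively open subset of `H` has
positive measure. The empty set is self-supporting. -/
def IsSelfSupporting (H : Set (ℕ → Bool)) : Prop :=
  ∀ U, IsOpen U → (H ∩ U).Nonempty → 0 < cantorMeasure (H ∩ U)

theorem coinMeasure_singleton (b : Bool) : coinMeasure {b} = 2⁻¹ := by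
  simp [coinMeasure]

theorem isSelfSupporting_univ : IsSelfSupporting univ := by
  rintro U hU ⟨x, -, hx⟩
  obtain ⟨s, u, hu, hsU⟩ := isOpen_pi_iff.1 hU x hx
  rw [univ_inter]
  refine lt_of_lt_of_le ?_ (measure_mono (μ := cantorMeasure)
    (show (s : Set ℕ).pi (fun i => {x i}) ⊆ U from fun y hy => hsU fun i hi => by
      have h1 : y i = x i := hy i hi
      rw [h1]; exact (hu i hi).2))
  rw [cantorMeasure, Measure.infinitePi_pi _ fun i _ => measurableSet_singleton _]
  simp [coinMeasure_singleton, pos_iff_ne_zero]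

theorem tsum_two_inv_pow_add_two : ∑' q : ℕ, (2⁻¹ : ENNReal) ^ (q + 2) = 2⁻¹ := by
  simp_rw [pow_add]
  rw [ENNReal.tsum_mul_right, ENNReal.tsum_geometric, ENNReal.one_sub_inv_two, inv_inv, pow_two,
    ← mul_assoc, ENNReal.mul_inv_cancel two_ne_zero ENNReal.ofNat_ne_top, one_mul]

theorem exists_isClopen_measure_le {N : Set (ℕ → Bool)} (hN : IsClosed N)
    (h0 : cantorMeasure N = 0) {ε : ENNReal} (hε : ε ≠ 0) :
    ∃ U, IsClopen U ∧ N ⊆ U ∧ cantorMeasure U ≤ ε := by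
  obtain ⟨O, hNO, hO, hOε⟩ := N.exists_isOpen_lt_of_lt ε (by rw [h0]; exact hε.bot_lt)
  obtain ⟨U, hU, hNU, hUO⟩ := exists_clopen_of_closed_subset_open hN hO hNO
  exact ⟨U, hU, hNU, (measure_mono hUO).trans hOε.le⟩

theorem exists_seq_isTopologicalBasis (Z : Type) [TopologicalSpace Z]
    [SecondCountableTopology Z] [Nonempty Z] :
    ∃ V : ℕ → Set Z, TopologicalSpace.IsTopologicalBasis (range V) := by
  have hb := TopologicalSpace.isBasis_countableBasis Z
  obtain ⟨V, hV⟩ := (TopologicalSpace.countable_countableBasis Z).exists_eq_range (by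
    obtain ⟨s, hs, -⟩ := hb.exists_subset_of_mem_open (mem_univ (Classical.arbitrary Z)) isOpen_univ
    exact ⟨s, hs⟩)
  exact ⟨V, hV ▸ hb⟩

/-- Countably many closed null sets can be avoided by a nonempty closed set whose intersection with
each of fewer than `𝔟` given self-supporting sets is self-supporting. The set is the complement of
a union of clopen neighbourhoods of the null sets; the `m`-th neighbourhood is required to be small
compared with what its predecessors leave of the traces of the given sets on the first `m` basic
open sets, and `𝔟` provides one choice that meets this requirement, from some `m` on, for each of
the given sets. -/
theorem exists_closed_avoiding {ι : Type} (h : #ι < boundingNumber) (H : ι → Set (ℕ → Bool))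
    (hH : ∀ i, IsSelfSupporting (H i)) (N : ℕ → Set (ℕ → Bool)) (hN : ∀ n, IsClosed (N n))
    (hN0 : ∀ n, cantorMeasure (N n) = 0) :
    ∃ F : Set (ℕ → Bool), IsClosed F ∧ F.Nonempty ∧ (∀ n, Disjoint F (N n)) ∧
      ∀ i, IsSelfSupporting (H i ∩ F) := by
  choose U hU hNU hUε using fun n k => exists_isClopen_measure_le (hN n) (hN0 n)
    (ε := (2⁻¹ : ENNReal) ^ (n + 2) * 2⁻¹ ^ k) (by simp)
  obtain ⟨V, hbasis⟩ := exists_seq_isTopologicalBasis (ℕ → Bool)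
  -- `W l` is the union of the first `m` neighbourhoods, the list `l` of length `m` recording,
  -- in reversed order, which of them were chosen.
  let W : List ℕ → Set (ℕ → Bool) := fun l => List.rec ∅ (fun k l w => U l.length k ∪ w) l
  have hW : ∀ l, IsClopen (W l) := fun l => by
    induction l with
    | nil => exact isClopen_empty
    | cons k l ih => exact (hU _ _).union ih
  have hthr : ∀ i l, ∃ k : ℕ, ∀ j ∈ Finset.range (l.length + 1), (H i ∩ (V j \ W l)).Nonempty →
      (2⁻¹ : ENNReal) ^ k ≤ cantorMeasure (H i ∩ (V j \ W l)) := fun i l => by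
    refine Eventually.exists (f := atTop) ((Finset.eventually_all _).2 fun j _ => ?_)
    by_cases hne : (H i ∩ (V j \ W l)).Nonempty
    · have hpos := hH i _ ((hbasis.isOpen (mem_range_self j)).sdiff (hW l).isClosed) hne
      filter_upwards [(ENNReal.tendsto_pow_atTop_nhds_zero_of_lt_one
        ENNReal.one_half_lt_one).eventually_lt_const hpos] with k hk _ using hk.le
    · exact Eventually.of_forall fun k hk => absurd hk hne
  choose thr hthr using hthr
  -- `G l` is the next choice after `l`; as the requirement `thr i l` depends on the choices already
  -- made, the domination takes place on lists.
  obtain ⟨G, hG⟩ := exists_cofinite_le_of_lt_boundingNumber h thr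
  let L : ℕ → List ℕ := fun m => Nat.rec [] (fun _ l => G l :: l) m
  have hL : ∀ m, (L m).length = m := fun m => by
    induction m with
    | zero => rfl
    | succ m ih => exact congrArg (· + 1) ih
  have hWL : ∀ m, W (L (m + 1)) = U m (G (L m)) ∪ W (L m) := fun m => by
    conv_rhs => rw [← hL m, hL m]
    change U (L m).length _ ∪ _ = _
    rw [hL m]
  have hmono : Monotone fun m => W (L m) := monotone_nat_of_le_succ fun m => by
    rw [hWL]; exact subset_union_right
  have hcover : ∀ m, ⋃ p, W (L p) ⊆ W (L m) ∪ ⋃ q, U (m + q) (G (L (m + q))) := fun m => by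
    have : ∀ q, W (L (m + q)) ⊆ W (L m) ∪ ⋃ q, U (m + q) (G (L (m + q))) := fun q => by
      induction q with
      | zero => exact subset_union_left
      | succ q ih =>
        rw [← add_assoc, hWL]
        exact union_subset ((subset_iUnion (fun q => U (m + q) (G (L (m + q)))) q).trans
          subset_union_right) ih
    exact iUnion_subset fun p => (hmono (Nat.le_add_left p m)).trans (this p)
  refine ⟨(⋃ m, W (L m))ᶜ, (isOpen_iUnion fun m => (hW _).isOpen).isClosed_compl, ?_, ?_, ?_⟩
  · rw [nonempty_compl]
    intro huniv
    have h1 : cantorMeasure (⋃ m, W (L m)) ≤ 2⁻¹ := by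
      refine (measure_mono ((hcover 0).trans (union_subset (empty_subset _) Subset.rfl))).trans
        ((measure_iUnion_le _).trans ?_)
      rw [← tsum_two_inv_pow_add_two]
      refine ENNReal.tsum_le_tsum fun q => (hUε _ _).trans ?_
      rw [zero_add]
      exact mul_le_of_le_one_right' (pow_le_one₀ bot_le ENNReal.one_half_lt_one.le)
    rw [huniv, measure_univ] at h1
    exact h1.not_gt ENNReal.one_half_lt_one
  · intro n
    rw [disjoint_compl_left_iff_subset]
    refine (hNU n (G (L n))).trans (Subset.trans ?_ (subset_iUnion _ (n + 1)))
    rw [hWL]; exact subset_union_left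
  · rintro i O hO ⟨x, ⟨hxH, hxF⟩, hxO⟩
    obtain ⟨_, ⟨j, rfl⟩, hxV, hVO⟩ := hbasis.exists_subset_of_mem_open hxO hO
    have hinj : Function.Injective L := fun a b hab => by rw [← hL a, hab, hL b]
    obtain ⟨m₀, hm₀⟩ := eventually_atTop.1
      ((Nat.cofinite_eq_atTop ▸ hinj.tendsto_cofinite).eventually (hG i))
    obtain ⟨m, hjm, hm⟩ : ∃ m, j ≤ m ∧ ∀ q, thr i (L (m + q)) ≤ G (L (m + q)) :=
      ⟨max m₀ j, le_max_right _ _, fun q => hm₀ _ ((le_max_left _ _).trans (Nat.le_add_right _ _))⟩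
    set p := cantorMeasure (H i ∩ (V j \ W (L m))) with hp
    have hxW : ∀ q, x ∉ W (L q) := fun q hq => hxF (mem_iUnion.2 ⟨q, hq⟩)
    have hsmall : ∀ q, (2⁻¹ : ENNReal) ^ G (L (m + q)) ≤ p := fun q => by
      refine (pow_le_pow_right_of_le_one' ENNReal.one_half_lt_one.le (hm q)).trans
        ((hthr i _ j ?_ ⟨x, hxH, hxV, hxW _⟩).trans ?_)
      · rw [Finset.mem_range, hL]; omega
      · exact measure_mono (inter_subset_inter_right _
          (sdiff_subset_sdiff_right (hmono (Nat.le_add_right m q))))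
    have hp0 : p ≠ 0 := fun h0 => by simpa [h0] using hsmall 0
    have hsum : cantorMeasure (⋃ q, U (m + q) (G (L (m + q)))) ≤ 2⁻¹ * p := by
      refine (measure_iUnion_le _).trans ?_
      rw [← tsum_two_inv_pow_add_two, ← ENNReal.tsum_mul_right]
      refine ENNReal.tsum_le_tsum fun q => (hUε _ _).trans (mul_le_mul' ?_ (hsmall q))
      exact pow_le_pow_right_of_le_one' ENNReal.one_half_lt_one.le (by omega)
    have hlt : 2⁻¹ * p < p := by
      have := ENNReal.half_lt_self hp0 (measure_ne_top _ _)
      rwa [ENNReal.div_eq_inv_mul] at this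
    calc 0 < p - 2⁻¹ * p := tsub_pos_of_lt hlt
      _ ≤ p - cantorMeasure (⋃ q, U (m + q) (G (L (m + q)))) := tsub_le_tsub_left hsum _
      _ ≤ cantorMeasure ((H i ∩ (V j \ W (L m))) \ ⋃ q, U (m + q) (G (L (m + q)))) :=
        le_measure_sdiff
      _ ≤ cantorMeasure (H i ∩ (⋃ m, W (L m))ᶜ ∩ O) := measure_mono fun y hy => ⟨⟨hy.1.1, fun hyW =>
          (hcover m hyW).elim hy.1.2.2 hy.2⟩, hVO hy.1.2.1⟩

/-- The construction of the closed sets `F t`: all their finite intersections are self-supporting,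
and `F t` avoids the null sets `N t n`. -/
theorem exists_selfSupporting_family {T : Type} [LinearOrder T] [WellFoundedLT T]
    (hT : ∀ t : T, #(Iio t) < boundingNumber) (N : T → ℕ → Set (ℕ → Bool))
    (hN : ∀ t n, IsClosed (N t n)) (hN0 : ∀ t n, cantorMeasure (N t n) = 0) :
    ∃ F : T → Set (ℕ → Bool), (∀ t, IsClosed (F t)) ∧ (∀ t, (F t).Nonempty) ∧
      (∀ t n, Disjoint (F t) (N t n)) ∧ ∀ s : Finset T, IsSelfSupporting (⋂ t ∈ s, F t) := by
  classical
  let Q : ∀ t : T, (Iio t → Set (ℕ → Bool)) → Set (ℕ → Bool) → Prop := fun t g A =>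
    ∀ s : Finset (Iio t), IsSelfSupporting ((⋂ u ∈ s, g u) ∩ A)
  have key : ∀ (F : T → Set (ℕ → Bool)) (s : Finset T), (∀ t ∈ s, Q t (fun u => F u) (F t)) →
      IsSelfSupporting (⋂ t ∈ s, F t) := fun F s => by
    induction s using Finset.induction_on_max with
    | empty => intro _; simpa using isSelfSupporting_univ
    | insert t s hs _ =>
      intro hQ
      have := hQ t (Finset.mem_insert_self t s) (s.subtype (· < t))
      convert this using 1
      ext x
      simp only [mem_iInter, Finset.mem_insert, mem_inter_iff]
      exact ⟨fun hx => ⟨fun u hu => hx u (Or.inr (Finset.mem_subtype.1 hu)), hx t (Or.inl rfl)⟩,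
        fun hx u hu => hu.elim (fun hut => hut ▸ hx.2) fun hus =>
          hx.1 ⟨u, hs u hus⟩ (Finset.mem_subtype.2 hus)⟩
  obtain ⟨F, hF⟩ := exists_forall_of_step (T := T) (α := Set (ℕ → Bool))
    (fun t g A => (IsClosed A ∧ A.Nonempty ∧ ∀ n, Disjoint A (N t n)) ∧ Q t g A)
    fun t F hF => by
      obtain ⟨A, hA1, hA2, hA3, hA4⟩ := exists_closed_avoiding
        (mk_finset_lt_boundingNumber (hT t)) (fun s => ⋂ u ∈ s, F u.1) (fun s => by
          have := key F (s.map (Function.Embedding.subtype _)) fun u hu => by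
            obtain ⟨v, -, rfl⟩ := Finset.mem_map.1 hu
            exact (hF v v.2).2
          simpa using this) (N t) (hN t) (hN0 t)
      exact ⟨A, ⟨hA1, hA2, hA3⟩, hA4⟩
  exact ⟨F, fun t => (hF t).1.1, fun t => (hF t).1.2.1, fun t => (hF t).1.2.2, fun s =>
    key F s fun t _ => (hF t).2⟩

/-! ### The sets of integers -/

theorem exists_seq_infinite_mem (Z : Type) [TopologicalSpace Z] [SecondCountableTopology Z]
    [Nonempty Z] : ∃ x : ℕ → Z, ∀ V, IsOpen V → V.Nonempty → {k | x k ∈ V}.Infinite := by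
  refine ⟨fun k => TopologicalSpace.denseSeq Z k.unpair.1, fun V hV hne => ?_⟩
  obtain ⟨_, hz, i, rfl⟩ := (TopologicalSpace.denseRange_denseSeq Z).inter_open_nonempty V hV hne
  refine infinite_of_injective_forall_mem (f := fun n => Nat.pair i n)
    (fun a b hab => ?_) fun n => ?_
  · simpa using hab
  · simpa using hz

theorem exists_antitone_isOpen_basis {Z : Type} [TopologicalSpace Z] [CompactSpace Z]
    [TopologicalSpace.MetrizableSpace Z] {F : Set Z} (hF : IsClosed F) :
    ∃ D : ℕ → Set Z, Antitone D ∧ (∀ n, IsOpen (D n)) ∧ (∀ n, F ⊆ D n) ∧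
      ∀ U, IsOpen U → F ⊆ U → ∃ n, D n ⊆ U := by
  let _ := TopologicalSpace.metrizableSpaceMetric Z
  refine ⟨fun n => Metric.thickening (1 / ((n : ℝ) + 1)) F, fun a b hab =>
    Metric.thickening_mono (Nat.one_div_le_one_div hab) _, fun n => Metric.isOpen_thickening,
    fun n => Metric.self_subset_thickening Nat.one_div_pos_of_nat _, fun U hU hFU => ?_⟩
  obtain ⟨δ, hδ, h⟩ := hF.isCompact.exists_thickening_subset_open hU hFU
  obtain ⟨n, hn⟩ := exists_nat_one_div_lt hδ
  exact ⟨n, (Metric.thickening_mono hn.le _).trans h⟩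

/-- For closed sets `F t` there are a sequence `x` and sets `C t` of integers such that `x`
converges to `F t` along `C t`, and otherwise the sets `C t` are as independent as possible: a
finite sign pattern `y` is realized infinitely often by `k` with `x k` near `z` as soon as `z` lies
in the sets `F t` that `y` selects. -/
theorem exists_independent_sets {Z T : Type} [TopologicalSpace Z] [CompactSpace Z]
    [TopologicalSpace.MetrizableSpace Z] [SecondCountableTopology Z] [Nonempty Z] [LinearOrder T]
    [WellFoundedLT T] (hT : ∀ t : T, #(Iio t) < boundingNumber) (F : T → Set Z)
    (hF : ∀ t, IsClosed (F t)) :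
    ∃ (x : ℕ → Z) (C : T → Set ℕ),
      (∀ t U, IsOpen U → F t ⊆ U → {k ∈ C t | x k ∉ U}.Finite) ∧
      ∀ (s : Finset T) (y : T → Bool) (V : Set Z) (z : Z), IsOpen V → z ∈ V →
        (∀ t ∈ s, y t = true → z ∈ F t) →
        {k | x k ∈ V ∧ ∀ t ∈ s, (k ∈ C t ↔ y t = true)}.Infinite := by
  classical
  obtain ⟨x, hx⟩ := exists_seq_infinite_mem Z
  obtain ⟨V, hbasis⟩ := exists_seq_isTopologicalBasis Z
  let Q : ∀ t : T, (Iio t → Set ℕ) → Set ℕ → Prop := fun t g A =>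
    ∀ (s : Finset (Iio t)) (y : T → Bool) (V : Set Z) (z : Z), IsOpen V → z ∈ V →
      (∀ u ∈ s, y u = true → z ∈ F u) →
      (z ∈ F t → ({k | x k ∈ V ∧ ∀ u ∈ s, (k ∈ g u ↔ y u = true)} ∩ A).Infinite) ∧
      ({k | x k ∈ V ∧ ∀ u ∈ s, (k ∈ g u ↔ y u = true)} \ A).Infinite
  have key : ∀ (C : T → Set ℕ) (s : Finset T), (∀ t ∈ s, Q t (fun u => C u) (C t)) →
      ∀ (y : T → Bool) (V : Set Z) (z : Z), IsOpen V → z ∈ V →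
        (∀ t ∈ s, y t = true → z ∈ F t) →
        {k | x k ∈ V ∧ ∀ t ∈ s, (k ∈ C t ↔ y t = true)}.Infinite := fun C s => by
    induction s using Finset.induction_on_max with
    | empty => intro _ y V z hV hz _; simpa using hx V hV ⟨z, hz⟩
    | insert t s hs _ =>
      intro hQ y V z hV hz hzF
      have := hQ t (Finset.mem_insert_self t s) (s.subtype (· < t)) y V z hV hz fun u hu =>
        hzF u (Finset.mem_insert_of_mem (Finset.mem_subtype.1 hu))
      cases hy : y t
      · refine this.2.mono fun k hk => ⟨hk.1.1, fun u hu => ?_⟩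
        obtain rfl | hu := Finset.mem_insert.1 hu
        · simpa [hy] using hk.2
        · exact hk.1.2 ⟨u, hs u hu⟩ (Finset.mem_subtype.2 hu)
      · refine (this.1 (hzF t (Finset.mem_insert_self t s) hy)).mono fun k hk =>
          ⟨hk.1.1, fun u hu => ?_⟩
        obtain rfl | hu := Finset.mem_insert.1 hu
        · simpa [hy] using hk.2
        · exact hk.1.2 ⟨u, hs u hu⟩ (Finset.mem_subtype.2 hu)
  obtain ⟨C, hC⟩ := exists_forall_of_step (T := T) (α := Set ℕ)
    (fun t g A => (∀ U, IsOpen U → F t ⊆ U → {k ∈ A | x k ∉ U}.Finite) ∧ Q t g A)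
    fun t C hC => by
      obtain ⟨D, hD, hDo, hFD, hDU⟩ := exists_antitone_isOpen_basis (hF t)
      -- The sign patterns on a finite set `s` are coded by finite sets `e`, so that there are
      -- fewer than `𝔟` sets to be split.
      let ι := {p : ℕ × Finset (Iio t) × Finset (Iio t) //
        ∃ z ∈ V p.1, ∀ u ∈ p.2.1, u ∈ p.2.2 → z ∈ F u}
      have hι : #ι < boundingNumber := (Cardinal.mk_subtype_le _).trans_lt <|
        mk_prod_lt_boundingNumber (by simpa using aleph0_lt_boundingNumber) <|
          mk_prod_lt_boundingNumber (mk_finset_lt_boundingNumber (hT t))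
            (mk_finset_lt_boundingNumber (hT t))
      have hB : ∀ (s e : Finset (Iio t)) (V : Set Z) (z : Z), IsOpen V → z ∈ V →
          (∀ u ∈ s, u ∈ e → z ∈ F u) →
          {k | x k ∈ V ∧ ∀ u ∈ s, (k ∈ C u ↔ u ∈ e)}.Infinite := fun s e V z hV hz h => by
        have := key C (s.map (Function.Embedding.subtype _)) (fun u hu => by
            obtain ⟨v, -, rfl⟩ := Finset.mem_map.1 hu
            exact (hC v v.2).2) (fun u => decide (∃ hu : u < t, (⟨u, hu⟩ : Iio t) ∈ e)) V z hV hz (by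
            intro u hu hue
            obtain ⟨v, hv, rfl⟩ := Finset.mem_map.1 hu
            exact h v hv (of_decide_eq_true hue).2)
        refine this.mono fun k hk => ⟨hk.1, fun u hu => ?_⟩
        refine (hk.2 u (Finset.mem_map_of_mem _ hu)).trans ?_
        rw [decide_eq_true_iff]
        exact ⟨fun h => h.2, fun h => ⟨u.2, h⟩⟩
      obtain ⟨A, hAD, hA⟩ := exists_splitting_pseudoIntersection hι
        (fun p => {k | x k ∈ V p.1.1 ∧ ∀ u ∈ p.1.2.1, (k ∈ C u ↔ u ∈ p.1.2.2)})
        (fun ⟨⟨j, s, e⟩, z, hz, h⟩ => hB s e _ z (hbasis.isOpen (mem_range_self j)) hz h)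
        (fun n => x ⁻¹' D n) (fun a b hab => preimage_mono (hD hab))
      refine ⟨A, fun U hU hFU => ?_, fun s y O z hO hz hzF => ?_⟩
      · obtain ⟨n, hn⟩ := hDU U hU hFU
        exact (hAD n).subset fun k hk => ⟨hk.1, fun hk' => hk.2 (hn hk')⟩
      · obtain ⟨_, ⟨j, rfl⟩, hzV, hVO⟩ := hbasis.exists_subset_of_mem_open hz hO
        let e : Finset (Iio t) := s.filter fun u => y u = true
        have he : ∀ u ∈ s, u ∈ e → z ∈ F u := fun u hu hue =>
          hzF u hu (Finset.mem_filter.1 hue).2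
        have hsub : {k | x k ∈ V j ∧ ∀ u ∈ s, (k ∈ C u ↔ u ∈ e)} ⊆
            {k | x k ∈ O ∧ ∀ u ∈ s, (k ∈ C u ↔ y u = true)} := fun k hk =>
          ⟨hVO hk.1, fun u hu => (hk.2 u hu).trans (by simp [e, hu])⟩
        have hA' := hA ⟨(j, s, e), z, hzV, he⟩
        refine ⟨fun hzt => (hA'.1 fun n => ?_).mono (inter_subset_inter_left _ hsub),
          hA'.2.mono (sdiff_subset_sdiff_left hsub)⟩
        refine (hB s e (V j ∩ D n) z ((hbasis.isOpen (mem_range_self j)).inter (hDo n))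
          ⟨hzV, hFD n hzt⟩ he).mono ?_
        rintro k ⟨hk1, hk2⟩
        exact ⟨⟨hk1.1, hk2⟩, hk1.2⟩
  exact ⟨x, C, fun t => (hC t).1, fun s => key C s fun t _ => (hC t).2⟩

/-! ### Compactifications with a prescribed remainder -/

/-- The cluster points of any sequence in a compact Hausdorff space form the remainder of a
compactification of `ω`: take the closure of the graph of the sequence over `ω ∪ {∞}`. -/
theorem exists_compactification {W : Type} [TopologicalSpace W] [CompactSpace W] [T2Space W]
    (h : ℕ → W) :
    ∃ (X : Type) (_ : TopologicalSpace X) (γ : ℕ → X), IsCompactification γ ∧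
      CompactSpace (Remainder γ) ∧ T2Space (Remainder γ) ∧
      ∃ π : Remainder γ → W, IsEmbedding π ∧ range π = {w | MapClusterPt w atTop h} := by
  let e : ℕ → W × OnePoint ℕ := fun k => (h k, k)
  let γ : ℕ → closure (range e) := fun k => ⟨e k, subset_closure (mem_range_self k)⟩
  have : CompactSpace (closure (range e)) :=
    isCompact_iff_compactSpace.1 isClosed_closure.isCompact
  have hemb : IsEmbedding γ := by
    refine IsEmbedding.of_comp continuous_of_discreteTopology
      (g := fun p : closure (range e) => p.1.2) (by fun_prop) ?_
    exact OnePoint.isOpenEmbedding_coe.isEmbedding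
  have hdense : DenseRange γ := by
    rw [DenseRange, Subtype.dense_iff]
    refine closure_mono ?_
    rintro _ ⟨k, rfl⟩
    exact ⟨γ k, mem_range_self k, rfl⟩
  have hrange : ∀ p : closure (range e), p ∈ range γ ↔ p.1.2 ≠ OnePoint.infty := fun p => by
    refine ⟨?_, fun hp => ?_⟩
    · rintro ⟨k, rfl⟩
      exact OnePoint.coe_ne_infty k
    · obtain ⟨n, hn⟩ := OnePoint.ne_infty_iff_exists.1 hp
      have hO : IsOpen {q : W × OnePoint ℕ | q.2 = (n : OnePoint ℕ)} := by
        refine IsOpen.preimage continuous_snd (t := {(n : OnePoint ℕ)}) ?_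
        simpa using OnePoint.isOpenEmbedding_coe.isOpenMap {n} (isOpen_discrete _)
      have hp' : p.1 ∈ closure ({q | q.2 = (n : OnePoint ℕ)} ∩ range e) :=
        hO.inter_closure ⟨hn.symm, p.2⟩
      have hsub : {q | q.2 = (n : OnePoint ℕ)} ∩ range e ⊆ {e n} := by
        rintro _ ⟨hk, k, rfl⟩
        rw [OnePoint.coe_injective (show (k : OnePoint ℕ) = n from hk)]
        rfl
      have := closure_mono hsub hp'
      rw [closure_singleton] at this
      exact ⟨n, Subtype.ext (Eq.symm this)⟩
  have hclosed : IsClosed (range γ)ᶜ := by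
    rw [isClosed_compl_iff]
    have : range γ = (fun p : closure (range e) => p.1.2) ⁻¹' {OnePoint.infty}ᶜ :=
      Set.ext fun p => hrange p
    rw [this]
    exact isOpen_compl_singleton.preimage (by fun_prop)
  have hinf : ∀ p : Remainder γ, p.1.1.2 = OnePoint.infty := fun p => by
    by_contra hp
    exact p.2 ((hrange p.1).2 hp)
  have hcl : ∀ w : W, (w, OnePoint.infty) ∈ closure (range e) ↔ MapClusterPt w atTop h := by
    intro w
    rw [mapClusterPt_iff_frequently]
    refine ⟨fun hw s hs => ?_, fun hw => ?_⟩
    · rw [Nat.frequently_atTop_iff_infinite]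
      intro hfin
      have hn : s ×ˢ ((fun k : ℕ => (k : OnePoint ℕ)) '' {k | h k ∈ s})ᶜ ∈
          𝓝 (w, (OnePoint.infty : OnePoint ℕ)) := by
        refine prod_mem_nhds hs ((hfin.image _).isClosed.isOpen_compl.mem_nhds ?_)
        rintro ⟨k, -, hk⟩
        exact OnePoint.coe_ne_infty k hk
      obtain ⟨_, ⟨h1, h2⟩, k, rfl⟩ := mem_closure_iff_nhds.1 hw _ hn
      exact h2 ⟨k, h1, rfl⟩
    · rw [mem_closure_iff_nhds]
      intro t ht
      obtain ⟨u, hu, v, hv, huv⟩ := mem_nhds_prod_iff.1 ht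
      have hv' : ∀ᶠ k : ℕ in atTop, (k : OnePoint ℕ) ∈ v := by
        rw [← Nat.cofinite_eq_atTop, ← cocompact_eq_cofinite]
        have := OnePoint.tendsto_nhds_infty (f := fun q : OnePoint ℕ => q)
          (l := 𝓝 (OnePoint.infty : OnePoint ℕ)) |>.1 tendsto_id v hv
        obtain ⟨-, t, -, ht, htv⟩ := this
        exact mem_cocompact.2 ⟨t, ht, htv⟩
      obtain ⟨k, hku, hkv⟩ := ((hw u hu).and_eventually hv').exists
      exact ⟨e k, huv ⟨hku, hkv⟩, k, rfl⟩
  have hcompact : CompactSpace (Remainder γ) := isCompact_iff_compactSpace.1 hclosed.isCompact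
  refine ⟨closure (range e), inferInstance, γ, ⟨this, inferInstance, hemb, hdense⟩, hcompact,
    inferInstance, fun p => p.1.1.1, ?_, ?_⟩
  · refine (Continuous.isClosedEmbedding (by fun_prop) fun p q hpq => ?_).isEmbedding
    exact Subtype.ext (Subtype.ext (Prod.ext hpq ((hinf p).trans (hinf q).symm)))
  · ext w
    refine ⟨?_, fun hw => ?_⟩
    · rintro ⟨p, rfl⟩
      refine (hcl _).1 ?_
      rw [← hinf p]
      exact p.1.2
    · exact ⟨⟨⟨(w, OnePoint.infty), (hcl w).2 hw⟩, fun hp => (hrange _).1 hp rfl⟩, rfl⟩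

/-- The cluster points of the sequence `k ↦ (x k, (1_{C t}(k))_t)`, in terms of the sets `F t`: the
convergence of `x` to `F t` along `C t` is one inclusion, the independence of the sets `C t` the
other. -/
theorem mapClusterPt_iff_of_independent {Z T : Type} [TopologicalSpace Z] [T2Space Z]
    [CompactSpace Z] {F : T → Set Z} (hF : ∀ t, IsClosed (F t)) {x : ℕ → Z} {C : T → Set ℕ}
    (hconv : ∀ t U, IsOpen U → F t ⊆ U → {k ∈ C t | x k ∉ U}.Finite)
    (hind : ∀ (s : Finset T) (y : T → Bool) (V : Set Z) (z : Z), IsOpen V → z ∈ V →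
        (∀ t ∈ s, y t = true → z ∈ F t) →
        {k | x k ∈ V ∧ ∀ t ∈ s, (k ∈ C t ↔ y t = true)}.Infinite)
    {h : ℕ → Z × (T → Bool)} (hx : ∀ k, (h k).1 = x k) (hC : ∀ k t, (h k).2 t = true ↔ k ∈ C t)
    (w : Z × (T → Bool)) :
    MapClusterPt w atTop h ↔ ∀ t, w.2 t = true → w.1 ∈ F t := by
  rw [mapClusterPt_iff_frequently]
  refine ⟨fun hw t ht => ?_, fun hw s hs => ?_⟩
  · by_contra hz
    obtain ⟨U, O, hU, hO, hFU, hzO, hUO⟩ := SeparatedNhds.of_isCompact_isCompact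
      (hF t).isCompact (isCompact_singleton (x := w.1)) (by simpa using hz)
    have hopen : IsOpen {v : Z × (T → Bool) | v.1 ∈ O ∧ v.2 t = true} :=
      (hO.preimage continuous_fst).inter <|
        (isOpen_discrete {true}).preimage
          (show Continuous fun v : Z × (T → Bool) => v.2 t by fun_prop)
    have := hw _ (hopen.mem_nhds ⟨hzO rfl, ht⟩)
    rw [Nat.frequently_atTop_iff_infinite] at this
    refine this ((hconv t U hU hFU).subset ?_)
    rintro k ⟨hk1, hk2⟩
    exact ⟨(hC k t).1 hk2, fun hk => hUO.le_bot ⟨hk, hx k ▸ hk1⟩⟩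
  · obtain ⟨u, hu, v, hv, huv⟩ := mem_nhds_prod_iff.1 hs
    obtain ⟨V, hVu, hV, hwV⟩ := mem_nhds_iff.1 hu
    obtain ⟨O, hOv, hO, hwO⟩ := mem_nhds_iff.1 hv
    obtain ⟨s, c, hc, hsc⟩ := isOpen_pi_iff.1 hO w.2 hwO
    rw [Nat.frequently_atTop_iff_infinite]
    refine (hind s w.2 V w.1 hV hwV fun t _ => hw t).mono ?_
    rintro k ⟨hk1, hk2⟩
    refine huv ⟨hVu (by rwa [hx k]), hOv (hsc fun t ht => ?_)⟩
    have : (h k).2 t = w.2 t := by rw [Bool.eq_iff_iff, hC k t, hk2 t ht]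
    rw [this]
    exact (hc t ht).2

/-! ### Strictly positive measures -/

open scoped CompactlySupported in
/-- A probability measure on `Ω` is transported to a regular Borel measure on the compact space
`R` by a map `φ` that need not be Borel: it is enough that the continuous functions `f` with `f ∘ φ`
measurable separate points, since by the Stone–Weierstrass theorem `f ∘ φ` is then measurable for
every continuous `f`. In the last hypothesis `φ ⁻¹' U` may be nonmeasurable, and `P` is its outer
measure. -/
theorem exists_regular_strictlyPositive {R Ω : Type} [TopologicalSpace R] [CompactSpace R]
    [T2Space R] [MeasurableSpace R] [BorelSpace R] [MeasurableSpace Ω] (P : Measure Ω)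
    [IsProbabilityMeasure P] (φ : Ω → R)
    (hsep : ∀ p q : R, p ≠ q → ∃ f : C(R, ℝ), Measurable (fun ω => f (φ ω)) ∧ f p ≠ f q)
    (hpos : ∀ U : Set R, IsOpen U → U.Nonempty → P (φ ⁻¹' U) ≠ 0) :
    ∃ μ : Measure R, IsProbabilityMeasure μ ∧ μ.Regular ∧
      ∀ U : Set R, IsOpen U → U.Nonempty → 0 < μ U := by
  let A : Subalgebra ℝ C(R, ℝ) :=
    { carrier := {f | Measurable fun ω => f (φ ω)}
      mul_mem' := fun hf hg => Measurable.mul hf hg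
      add_mem' := fun hf hg => Measurable.add hf hg
      algebraMap_mem' := fun c => measurable_const }
  have hA : A.SeparatesPoints := fun p q hpq => by
    obtain ⟨f, hf, hne⟩ := hsep p q hpq
    exact ⟨f, ⟨f, hf, rfl⟩, hne⟩
  have hmeas : ∀ f : C(R, ℝ), Measurable fun ω => f (φ ω) := fun f => by
    have hf : f ∈ A.topologicalClosure := by
      rw [ContinuousMap.subalgebra_topologicalClosure_eq_top_of_separatesPoints A hA]
      exact Algebra.mem_top
    obtain ⟨u, hu, hlim⟩ := mem_closure_iff_seq_limit.1 hf
    refine measurable_of_tendsto_metrizable (f := fun n ω => u n (φ ω)) hu ?_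
    exact tendsto_pi_nhds.2 fun ω =>
      ((continuous_eval_const (F := C(R, ℝ)) (φ ω)).tendsto f).comp hlim
  have hint : ∀ f : C(R, ℝ), Integrable (fun ω => f (φ ω)) P := fun f =>
    Integrable.of_bound (hmeas f).aestronglyMeasurable ‖f‖
      (Eventually.of_forall fun ω => f.norm_coe_le_norm _)
  let Λ : C_c(R, ℝ) →ₚ[ℝ] ℝ :=
    { toFun g := ∫ ω, g (φ ω) ∂P
      map_add' g g' := integral_add (hint g) (hint g')
      map_smul' c g := integral_const_mul c _
      monotone' g g' hgg' := integral_mono (hint g) (hint g') fun ω => hgg' (φ ω) }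
  have hΛ : ∀ f : C(R, ℝ), ∫ p, f p ∂(RealRMK.rieszMeasure Λ) = ∫ ω, f (φ ω) ∂P := fun f =>
    RealRMK.integral_rieszMeasure Λ ⟨f, HasCompactSupport.of_compactSpace f⟩
  refine ⟨RealRMK.rieszMeasure Λ, ⟨?_⟩, inferInstance, fun U hU ⟨p, hp⟩ => ?_⟩
  · have := hΛ 1
    simp only [ContinuousMap.one_apply, integral_const, smul_eq_mul, mul_one, probReal_univ] at this
    rwa [measureReal_def, ENNReal.toReal_eq_one_iff] at this
  · rw [pos_iff_ne_zero]
    intro h0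
    obtain ⟨f, hf0, hf1, hf01⟩ := exists_continuous_zero_one_of_isClosed hU.isClosed_compl
      (isClosed_singleton (x := p)) (by simpa using hp)
    have h1 : ∫ q, f q ∂(RealRMK.rieszMeasure Λ) = 0 := by
      refine integral_eq_zero_of_ae ?_
      filter_upwards [measure_eq_zero_iff_ae_notMem.1 h0] with q hq
      exact hf0 hq
    rw [hΛ, integral_eq_zero_iff_of_nonneg (fun ω => (hf01 _).1) (hint f)] at h1
    refine hpos {q | f q ≠ 0} (isOpen_ne_fun f.continuous continuous_const) ⟨p, ?_⟩ h1
    have : f p = 1 := hf1 rfl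
    simp [this]

/-- If `R` is homeomorphic to
`{(z, y) | y t = 1 → z ∈ F t}` and finite intersections of the sets `F t` are self-supporting,
then `R` carries a strictly positive measure. The measure is the distribution of the random point
whose first coordinate `z` is distributed according to `λ` and for which `y t` is decided, given
`z`, by independent coin flips for those `t` with `z ∈ F t`. -/
theorem exists_strictlyPositive_of_selfSupporting {T R : Type} [TopologicalSpace R]
    [CompactSpace R] [T2Space R] [MeasurableSpace R] [BorelSpace R]
    {F : T → Set (ℕ → Bool)} (hF : ∀ t, IsClosed (F t))
    (hself : ∀ s : Finset T, IsSelfSupporting (⋂ t ∈ s, F t)) {π : R → (ℕ → Bool) × (T → Bool)}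
    (hπ : IsEmbedding π) (hrange : range π = {w | ∀ t, w.2 t = true → w.1 ∈ F t}) :
    ∃ μ : Measure R, IsProbabilityMeasure μ ∧ μ.Regular ∧
      ∀ U : Set R, IsOpen U → U.Nonempty → 0 < μ U := by
  classical
  have hex : ∀ ω : (ℕ → Bool) × (T → Bool),
      ∃ p : R, π p = (ω.1, fun t => ω.2 t && decide (ω.1 ∈ F t)) := fun ω => by
    have hω : (ω.1, fun t => ω.2 t && decide (ω.1 ∈ F t)) ∈ range π := by
      rw [hrange]
      intro t ht
      simp only [Bool.and_eq_true, decide_eq_true_eq] at ht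
      exact ht.2
    exact hω
  choose φ hφ using hex
  refine exists_regular_strictlyPositive
    (cantorMeasure.prod (Measure.infinitePi fun _ : T => coinMeasure)) φ (fun p q hpq => ?_)
    fun U hU ⟨p, hp⟩ => ?_
  · let c : C(Bool, ℝ) := ⟨fun b => cond b 1 0, continuous_of_discreteTopology⟩
    have hc : ∀ a b, a ≠ b → c a ≠ c b := by
      intro a b hab
      cases a <;> cases b <;> simp [c] at hab ⊢
    have hcm : Measurable c := measurable_of_countable _
    have hne : π p ≠ π q := hπ.injective.ne hpq
    by_cases h1 : (π p).1 = (π q).1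
    · have h2 : (π p).2 ≠ (π q).2 := fun h2 => hne (Prod.ext h1 h2)
      obtain ⟨t, ht⟩ := Function.ne_iff.1 h2
      refine ⟨c.comp ⟨fun r => (π r).2 t, (continuous_apply t).comp
        (continuous_snd.comp hπ.continuous)⟩, hcm.comp ?_, hc _ _ ht⟩
      simp only [ContinuousMap.coe_mk, hφ]
      have hd : Measurable fun ω : (ℕ → Bool) × (T → Bool) => decide (ω.1 ∈ F t) :=
        measurable_to_bool (by
          have : (fun ω : (ℕ → Bool) × (T → Bool) => decide (ω.1 ∈ F t)) ⁻¹' {true} =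
            Prod.fst ⁻¹' F t := by ext; simp
          rw [this]
          exact measurable_fst (hF t).measurableSet)
      exact (measurable_of_countable fun b : Bool × Bool => b.1 && b.2).comp
        (((measurable_pi_apply t).comp measurable_snd).prodMk hd)
    · obtain ⟨i, hi⟩ := Function.ne_iff.1 h1
      refine ⟨c.comp ⟨fun r => (π r).1 i, (continuous_apply i).comp
        (continuous_fst.comp hπ.continuous)⟩, hcm.comp ?_, hc _ _ hi⟩
      simp only [ContinuousMap.coe_mk, hφ]
      exact (measurable_pi_apply i).comp measurable_fst
  · obtain ⟨O, hO, rfl⟩ := hπ.isOpen_iff.1 hU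
    have hpK : π p ∈ {w : (ℕ → Bool) × (T → Bool) | ∀ t, w.2 t = true → w.1 ∈ F t} :=
      hrange ▸ mem_range_self p
    obtain ⟨V, V', hV, hV', hpV, hpV', hVO⟩ := isOpen_prod_iff.1 hO (π p).1 (π p).2 hp
    obtain ⟨s, u, hu, hsu⟩ := isOpen_pi_iff.1 hV' _ hpV'
    let s' := s.filter fun t => (π p).2 t = true
    have hsub : ((⋂ t ∈ s', F t) ∩ V) ×ˢ ((s : Set T).pi fun t => {(π p).2 t}) ⊆
        φ ⁻¹' (π ⁻¹' O) := by
      rintro ⟨z, y⟩ ⟨⟨hz, hzV⟩, hy⟩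
      rw [mem_preimage, mem_preimage, hφ]
      refine hVO ⟨hzV, hsu fun t ht => ?_⟩
      have hyt : y t = (π p).2 t := hy t ht
      suffices (y t && decide (z ∈ F t)) = (π p).2 t by
        change (y t && decide (z ∈ F t)) ∈ u t
        rw [this]
        exact (hu t ht).2
      rw [hyt]
      cases hpt : (π p).2 t
      · rfl
      · have : z ∈ F t := mem_iInter₂.1 hz t (Finset.mem_filter.2 ⟨ht, hpt⟩)
        simp [this]
    refine (lt_of_lt_of_le ?_ (measure_mono hsub)).ne'
    rw [Measure.prod_prod]
    refine ENNReal.mul_pos (hself s' V hV ⟨(π p).1, mem_iInter₂.2 fun t ht =>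
      hpK t (Finset.mem_filter.1 ht).2, hpV⟩).ne' ?_
    rw [Measure.infinitePi_pi _ fun i _ => measurableSet_singleton _]
    simp [coinMeasure_singleton]

/-! ### Coverings by null sets -/

theorem cantorMeasure_singleton (x : ℕ → Bool) : cantorMeasure {x} = 0 := by
  refine le_antisymm (ge_of_tendsto' (ENNReal.tendsto_pow_atTop_nhds_zero_of_lt_one
    ENNReal.one_half_lt_one) fun n => ?_) bot_le
  refine (measure_mono (show {x} ⊆ (Finset.range n : Set ℕ).pi fun i => {x i} from ?_)).trans ?_
  · rintro _ rfl i -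
    rfl
  · rw [cantorMeasure, Measure.infinitePi_pi _ fun i _ => measurableSet_singleton _]
    simp [coinMeasure_singleton]

theorem range_singleton_subset_idealE :
    range (fun x : ℕ → Bool => ({x} : Set (ℕ → Bool))) ⊆ idealE := by
  rintro _ ⟨x, rfl⟩
  simp [idealE, cantorMeasure_singleton]

theorem sUnion_range_singleton : ⋃₀ range (fun x : ℕ → Bool => ({x} : Set (ℕ → Bool))) = univ := by
  ext x; simp

theorem covE_le_continuum : covE ≤ Cardinal.continuum := by
  refine le_trans (csInf_le' ⟨_, range_singleton_subset_idealE, sUnion_range_singleton, rfl⟩) ?_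
  refine Cardinal.mk_range_le.trans ?_
  simp

/-- A covering of `2^ω` by closed null sets indexed by `cov(𝓔)`. -/
theorem exists_covE_cover : ∃ N : covE.out → Set (ℕ → Bool), (∀ a, IsClosed (N a)) ∧
    (∀ a, cantorMeasure (N a) = 0) ∧ ∀ x, ∃ a, x ∈ N a := by
  obtain ⟨F, hF, hU, hc⟩ : covE ∈ _ :=
    csInf_mem ⟨_, _, range_singleton_subset_idealE, sUnion_range_singleton, rfl⟩
  obtain ⟨e⟩ : Nonempty (covE.out ≃ F) := Cardinal.eq.1 (by rw [Cardinal.mk_out, hc])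
  refine ⟨fun a => closure (e a), fun a => isClosed_closure, fun a => hF (e a).2, fun x => ?_⟩
  obtain ⟨A, hA, hx⟩ := mem_sUnion.1 (hU ▸ mem_univ x)
  exact ⟨e.symm ⟨A, hA⟩, subset_closure (by simpa using hx)⟩

theorem cofinalityAssumption_of_boundingNumber_eq_continuum
    (h : boundingNumber = Cardinal.continuum) : CofinalityAssumption := by
  rw [CofinalityAssumption, h]
  calc Order.cof (CountableSubsets covE) ≤ #(CountableSubsets covE) := Order.cof_le_cardinalMk _
    _ = #{A : Set covE.out // #A ≤ ℵ₀} := by simp_rw [Cardinal.le_aleph0_iff_set_countable]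
    _ ≤ max #covE.out ℵ₀ ^ ℵ₀ := Cardinal.mk_bounded_set_le _ _
    _ ≤ Cardinal.continuum ^ ℵ₀ := Cardinal.power_le_power_right <|
        max_le (by rw [Cardinal.mk_out]; exact covE_le_continuum) Cardinal.aleph0_le_continuum
    _ = Cardinal.continuum := Cardinal.continuum_power_aleph0

/-! ### The compactification -/

theorem theorem1 :
    (boundingNumber = Cardinal.continuum → CofinalityAssumption) ∧
    (CofinalityAssumption →
      ∃ (X : Type) (_ : TopologicalSpace X) (_ : MeasurableSpace X) (_ : BorelSpace X) (γ : ℕ → X),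
        IsCompactification γ ∧
        ¬ TopologicalSpace.SeparableSpace (Remainder γ) ∧
        ∃ μ : Measure (Remainder γ),
          IsProbabilityMeasure μ ∧ μ.Regular ∧
          ∀ U : Set (Remainder γ), IsOpen U → U.Nonempty → 0 < μ U) := by
  classical
  refine ⟨cofinalityAssumption_of_boundingNumber_eq_continuum, fun hcof => ?_⟩
  obtain ⟨S, hS, hSc⟩ := Order.exists_cof_eq (CountableSubsets covE)
  let T : Type := (#S).ord.ToType
  obtain ⟨e⟩ : Nonempty (T ≃ S) := Cardinal.eq.1 (Cardinal.mk_ord_toType _)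
  let j : T → CountableSubsets covE := fun t => e t
  have hj : ∀ A, ∃ t, A ≤ j t := fun A => by
    obtain ⟨B, hB, hAB⟩ := hS A
    exact ⟨e.symm ⟨B, hB⟩, by simpa [j] using hAB⟩
  have hT : ∀ t : T, #(Iio t) < boundingNumber := fun t =>
    (Cardinal.mk_Iio_lt t (by simp [T])).trans_le
      ((Cardinal.mk_ord_toType _).trans_le (hSc.trans_le hcof))
  obtain ⟨N, hNc, hN0, hNU⟩ := exists_covE_cover
  have hM : ∀ t : T, ∃ M : ℕ → Set (ℕ → Bool), (∀ n, IsClosed (M n)) ∧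
      (∀ n, cantorMeasure (M n) = 0) ∧ ∀ a ∈ (j t).1, ∃ n, M n = N a := fun t => by
    obtain ⟨M, hM⟩ := (((j t).2.image N).insert ∅).exists_eq_range (insert_nonempty _ _)
    have hmem : ∀ n, M n = ∅ ∨ ∃ a ∈ (j t).1, N a = M n := fun n =>
      (hM ▸ mem_range_self n : M n ∈ insert ∅ (N '' (j t).1))
    refine ⟨M, fun n => ?_, fun n => ?_, fun a ha => ?_⟩
    · obtain h | ⟨a, -, h⟩ := hmem n
      · rw [h]; exact isClosed_empty
      · exact h ▸ hNc a
    · obtain h | ⟨a, -, h⟩ := hmem n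
      · rw [h]; exact measure_empty
      · exact h ▸ hN0 a
    · exact (hM ▸ mem_insert_of_mem _ (mem_image_of_mem N ha) : N a ∈ range M)
  choose M hMc hM0 hMN using hM
  obtain ⟨F, hFc, hFne, hFM, hFself⟩ := exists_selfSupporting_family hT M hMc hM0
  obtain ⟨x, C, hconv, hind⟩ := exists_independent_sets hT F hFc
  obtain ⟨X, _, γ, hγ, _, _, π, hπ, hrange⟩ :=
    exists_compactification fun k => (x k, fun t => decide (k ∈ C t))
  have hK : range π = {w | ∀ t, w.2 t = true → w.1 ∈ F t} := by
    rw [hrange]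
    ext w
    exact mapClusterPt_iff_of_independent hFc hconv hind (fun k => rfl) (fun k t => by simp) w
  let _ : MeasurableSpace X := borel X
  have : BorelSpace X := ⟨rfl⟩
  refine ⟨X, _, _, inferInstance, γ, hγ, fun _ => ?_,
    exists_strictlyPositive_of_selfSupporting hFc hFself hπ hK⟩
  obtain ⟨D, hDc, hD⟩ := TopologicalSpace.exists_countable_dense (Remainder γ)
  -- The first coordinates of the points of `D` lie in countably many of the covering null sets,
  -- all of which are avoided by some `F t`; hence `D` misses the open set `{y t = 1}`.
  choose a ha using fun p : Remainder γ => hNU (π p).1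
  obtain ⟨t, ht⟩ := hj ⟨a '' D, hDc.image a⟩
  have hopen : IsOpen {p : Remainder γ | (π p).2 t = true} :=
    (isOpen_discrete {true}).preimage
      ((continuous_apply t).comp (continuous_snd.comp hπ.continuous))
  obtain ⟨z, hz⟩ := hFne t
  have hne : {p : Remainder γ | (π p).2 t = true}.Nonempty := by
    obtain ⟨p, hp⟩ : (z, fun u => decide (u = t)) ∈ range π := by
      rw [hK]
      intro u hu
      rw [of_decide_eq_true hu]
      exact hz
    exact ⟨p, by simp [hp]⟩
  obtain ⟨p, hp, hpD⟩ := hD.inter_open_nonempty _ hopen hne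
  have hpF : (π p).1 ∈ F t :=
    (hK ▸ mem_range_self p : π p ∈ {w : _ × (T → Bool) | ∀ t, w.2 t = true → w.1 ∈ F t}) t hp
  obtain ⟨n, hn⟩ := hMN t (a p) (ht (mem_image_of_mem a hpD))
  exact (hFM t n).le_bot ⟨hpF, hn ▸ ha p⟩
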